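/- An instance of the Steiner tree problem consists of a finite undirected graph $G=(V,E)$, costs $c_e\ge 0$ for $e\in E$, and a set $R\subseteq V$ of terminals; the vertices of $V\setminus R$ are called Steiner vertices. Fix an arbitrary terminal $r\in R$ as root (so $R\neq\varnothing$). Let $\mathcal K$ be the set of all nonempty subsets of $R$ (hyperedges). A full component spanning $K\in\mathcal K$ is a subtree of $G$ whose set of terminals is exactly $K$, all of whose leaves are terminals and all of whose internal nodes are Steiner vertices (a single terminal is a full component). Let $C_K\in[0,\infty]$ be the minimum of $\sum_{e\in T}c_e$ over all full components $T$ spanning $K$, and $C_K=\infty$ if there is none; put $\infty\cdot 0=0$. For a partition $\pi$ of $R$ into nonempty parts, let $r(\pi)$ be its number of parts, and for $K\in\mathcal K$ let $\mathrm{rc}^\pi_K=|\{P\in\pi: K\cap P\ne\varnothing\}|-1$. The partition LP is $$(\mathcal P)\qquad \min\Big\{\sum_{K\in\mathcal K}C_Kx_K:\ x\in\mathbf R^{\mathcal K}_{\ge 0},\ \sum_{K\in\mathcal K}x_K\,\mathrm{rc}^\pi_K\ge r(\pi)-1\ \text{ for every partition }\pi\text{ of }R\Big\}.$$ The directed hypergraph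 LP has a variable $x_{K^i}$ for every $K\in\mathcal K$ and $i\in K$ (the hyperedge $K$ directed towards $i$), and is $$(\mathcal D)\qquad \min\Big\{\sum_{K\in\mathcal K,\,i\in K}C_Kx_{K^i}:\ x\ge 0,\ \sum_{K^i:\,K\cap U\neq\varnothing,\ i\notin U}x_{K^i}\ge 1\ \text{ for every nonempty }U\subseteq R\setminus\{r\}\Big\}.$$ Theorem. For every instance of the Steiner tree problem and every choice of the root $r\in R$, both minima are attained (in $[0,\infty]$) and the optimal values agree: $\mathrm{OPT}(\mathcal P)=\mathrm{OPT}(\mathcal D)$. -/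

import Mathlib

open scoped NNReal ENNReal

/-- An instance of the Steiner tree problem on the vertex set `V`: an undirected graph, non-negative
edge costs (only the values on edges of the graph are ever used), and a set of terminals. -/
structure SteinerInstance (V : Type*) where
  graph : SimpleGraph V
  cost : Sym2 V → ℝ≥0
  terminals : Finset V

namespace SteinerInstance

/-- `T` is a full component spanning `K`: a subtree of the graph whose leaves are terminals, whose
internal nodes are Steiner (non-terminal) nodes, and whose set of terminals is `K`.
A leaf is a node with at most one neighbour in `T`, so that a single terminal is a full
component. -/
structure IsFullComponent {V : Type*} (I : SteinerInstance V) (T : I.graph.Subgraph)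
    (K : Finset V) : Prop where
  isTree : T.coe.IsTree
  terminal_iff_leaf : ∀ v ∈ T.verts, v ∈ I.terminals ↔ (T.neighborSet v).Subsingleton
  terminals_eq : T.verts ∩ (I.terminals : Set V) = (K : Set V)

/-- The total cost of the edges of a subgraph. -/
noncomputable def subgraphCost {V : Type*} (I : SteinerInstance V) (T : I.graph.Subgraph) : ℝ≥0∞ :=
  ∑' e : T.edgeSet, (I.cost e : ℝ≥0∞)

/-- `C_K`: the minimum cost of a full component spanning `K`, and `∞` if there is none. -/
noncomputable def hyperedgeCost {V : Type*} (I : SteinerInstance V) (K : Finset V) : ℝ≥0∞ :=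
  ⨅ (T : I.graph.Subgraph) (_ : I.IsFullComponent T K), I.subgraphCost T

/-- The hyperedges: all nonempty sets of terminals. -/
def hyperedges {V : Type*} (I : SteinerInstance V) : Finset (Finset V) :=
  I.terminals.powerset.filter fun K => K.Nonempty

/-- The type of hyperedges, which indexes the variables of the partition LP. -/
abbrev Hyperedge {V : Type*} (I : SteinerInstance V) : Type _ :=
  {K : Finset V // K ∈ I.hyperedges}

/-- The directed hyperedges, which index the variables of the directed LP: `⟨K, i⟩`
with `i ∈ K` is the hyperedge `K` directed towards its head `i`. -/
abbrev DirHyperedge {V : Type*} (I : SteinerInstance V) : Type _ :=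
  Σ K : I.Hyperedge, {i : V // i ∈ K.1}

/-- The rank contribution of `K` for the partition `π`: the number of parts of `π` that meet `K`,
minus one. -/
def rankContribution {V : Type*} [DecidableEq V] {R : Finset V} (π : Finpartition R)
    (K : Finset V) : ℝ :=
  ((π.parts.filter fun P => (K ∩ P).Nonempty).card : ℝ) - 1

/-- Feasibility for the partition LP. -/
def PartitionFeasible {V : Type*} [DecidableEq V] (I : SteinerInstance V)
    (x : I.Hyperedge → ℝ≥0) : Prop :=
  ∀ π : Finpartition I.terminals,
    (π.parts.card : ℝ) - 1 ≤ ∑ K : I.Hyperedge, (x K : ℝ) * rankContribution π K.1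

/-- The objective of the partition LP, with `∞ * 0 = 0`. -/
noncomputable def partitionObjective {V : Type*} (I : SteinerInstance V)
    (x : I.Hyperedge → ℝ≥0) : ℝ≥0∞ :=
  ∑ K : I.Hyperedge, I.hyperedgeCost K.1 * (x K : ℝ≥0∞)

/-- A set of terminals is valid (for the root `r`) if it is nonempty and does not contain `r`. -/
def IsValid {V : Type*} (I : SteinerInstance V) (r : V) (U : Finset V) : Prop :=
  U ⊆ I.terminals ∧ U.Nonempty ∧ r ∉ U

/-- `Δ^out(U)`: the directed hyperedges that meet `U` and whose head is outside `U`. -/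
def outHyperedges {V : Type*} [DecidableEq V] (I : SteinerInstance V) (U : Finset V) :
    Finset I.DirHyperedge :=
  Finset.univ.filter fun e => (U ∩ e.1.1).Nonempty ∧ e.2.1 ∉ U

/-- Feasibility for the directed hypergraph LP with root `r`. -/
def DirectedFeasible {V : Type*} [DecidableEq V] (I : SteinerInstance V) (r : V)
    (x : I.DirHyperedge → ℝ≥0) : Prop :=
  ∀ U : Finset V, I.IsValid r U → 1 ≤ ∑ e ∈ I.outHyperedges U, x e

/-- The objective of the directed hypergraph LP, with `∞ * 0 = 0`. -/
noncomputable def directedObjective {V : Type*} (I : SteinerInstance V)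
    (x : I.DirHyperedge → ℝ≥0) : ℝ≥0∞ :=
  ∑ e : I.DirHyperedge, I.hyperedgeCost e.1.1 * (x e : ℝ≥0∞)

/-- The objective values of the feasible solutions of the partition LP. -/
def partitionValues {V : Type*} [DecidableEq V] (I : SteinerInstance V) : Set ℝ≥0∞ :=
  I.partitionObjective '' {x | I.PartitionFeasible x}

/-- The objective values of the feasible solutions of the directed hypergraph LP with root `r`. -/
def directedValues {V : Type*} [DecidableEq V] (I : SteinerInstance V) (r : V) : Set ℝ≥0∞ :=
  I.directedObjective '' {x | I.DirectedFeasible r x}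

/-- The optimal value of the partition LP. -/
noncomputable def optPartition {V : Type*} [DecidableEq V] (I : SteinerInstance V) : ℝ≥0∞ :=
  sInf I.partitionValues

/-- The optimal value of the directed hypergraph LP with root `r`. -/
noncomputable def optDirected {V : Type*} [DecidableEq V] (I : SteinerInstance V) (r : V) :
    ℝ≥0∞ :=
  sInf (I.directedValues r)

end SteinerInstance

/-!
The two linear programs have the same set of objective values. From a solution of the directed LP
one gets a solution of the partition LP of the same objective value by forgetting the heads
(`DirectedFeasible.partitionFeasible_forgetHeads`). The converse
(`PartitionFeasible.exists_directedFeasible`) is a fractional orientation theorem.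

Let `x` be a solution of the partition LP, let `cov U` be the weight of the hyperedges that meet
`U`, and suppose that `x` is distributed over heads so that the weight directed towards `i` is
`z i`. The constraint of a nonempty set `U` of terminals that avoids the root then reads
`z(U) ≤ cov U - 1`. The function that is `cov U - 1` on these sets and `cov U` on the sets
containing the root is intersecting submodular. By the min-max theorem for such functions
(`exists_le_intersecting_submodular`), there is a vector `z` below it whose total is the minimum,
over the partitions of the terminals, of the sum of its values on the parts; by the constraints of
the partition LP this is at least the total weight of `x`. Since moreover `z(U) ≤ cov U` for all
`U`, a fractional form of Hall's theorem (`exists_transport`) shows that `z` comes from an actual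
distribution of `x` over heads. Both auxiliary theorems rest on one greedy argument
(`exists_forall_mem_tight`) and the uncrossing of tight sets.

The directed LP attains its minimum because its variables can be capped at one, which leaves a
compact set, and its objective is lower semicontinuous also in the presence of infinite costs.
-/

/-! ### Greedy raising and intersecting submodular functions -/

/-- Greedy raising: from a solution `z₀` of a finite system of upper bounds `z(S c) ≤ f c`, the
coordinates in `A` can be raised one after the other until each of them lies in a tight
constraint. -/
theorem exists_forall_mem_tight {α ι : Type*} [DecidableEq α] (C : Finset ι) (S : ι → Finset α)
    (f : ι → ℝ) (z₀ : α → ℝ) (h₀ : ∀ c ∈ C, ∑ i ∈ S c, z₀ i ≤ f c) (A : Finset α)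
    (hA : ∀ i ∈ A, ∃ c ∈ C, i ∈ S c) :
    ∃ z : α → ℝ, (∀ c ∈ C, ∑ i ∈ S c, z i ≤ f c) ∧
      (∀ i ∈ A, ∃ c ∈ C, i ∈ S c ∧ ∑ j ∈ S c, z j = f c) ∧ ∀ i ∉ A, z i = z₀ i := by
  induction A using Finset.induction_on with
  | empty => exact ⟨z₀, h₀, by simp, by simp⟩
  | insert a A ha ih =>
    obtain ⟨z, hz, ht, hout⟩ := ih fun i hi => hA i (Finset.mem_insert_of_mem hi)
    obtain ⟨c₀, hc₀, hac₀⟩ := hA a (Finset.mem_insert_self a A)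
    obtain ⟨d, hd, hmin⟩ := Finset.exists_min_image (C.filter fun c => a ∈ S c)
      (fun c => f c - ∑ i ∈ S c, z i) ⟨c₀, by simp [hc₀, hac₀]⟩
    rw [Finset.mem_filter] at hd
    -- `ε` is the least slack of a constraint that contains `a`
    set ε : ℝ := f d - ∑ i ∈ S d, z i with hε
    have hε0 : 0 ≤ ε := sub_nonneg.2 (hz d hd.1)
    have hsum : ∀ c, ∑ i ∈ S c, (z i + if i = a then ε else 0)
        = ∑ i ∈ S c, z i + if a ∈ S c then ε else 0 := fun c => by
      rw [Finset.sum_add_distrib, Finset.sum_ite_eq']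
    refine ⟨fun i => z i + if i = a then ε else 0, fun c hc => ?_, fun i hi => ?_, fun i hi => ?_⟩
    · rw [hsum]
      split_ifs with hac
      · have := hmin c (by simp [hc, hac])
        linarith
      · simpa using hz c hc
    · rcases Finset.mem_insert.1 hi with rfl | hi
      · exact ⟨d, hd.1, hd.2, by rw [hsum, if_pos hd.2, hε]; ring⟩
      · obtain ⟨c, hc, hic, hct⟩ := ht i hi
        refine ⟨c, hc, hic, ?_⟩
        rw [hsum]
        split_ifs with hac
        · have := hmin c (by simp [hc, hac])
          linarith
        · linarith
    · rw [Finset.mem_insert, not_or] at hi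
      simp [hi.1, hout i hi.2]

/-- The min-max theorem for intersecting submodular functions, in the direction that produces a
vector: the maximal tight sets of a greedily raised vector are disjoint, so they form a partition
on which the upper bounds add up to `z(R)`. -/
theorem exists_le_intersecting_submodular {α : Type*} [DecidableEq α] (R : Finset α)
    (f : Finset α → ℝ) (m : ℝ)
    (hf : ∀ U ⊆ R, ∀ W ⊆ R, (U ∩ W).Nonempty → f (U ∪ W) + f (U ∩ W) ≤ f U + f W)
    (hm : ∀ π : Finpartition R, m ≤ ∑ P ∈ π.parts, f P) :
    ∃ z : α → ℝ, (∀ U ⊆ R, U.Nonempty → ∑ i ∈ U, z i ≤ f U) ∧ m ≤ ∑ i ∈ R, z i := by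
  set C : Finset (Finset α) := R.powerset.filter fun U => U.Nonempty with hC
  have memC : ∀ U, U ∈ C ↔ U ⊆ R ∧ U.Nonempty := by simp [hC]
  set M : ℝ := ∑ U ∈ C, |f U| with hM
  have hM0 : 0 ≤ M := Finset.sum_nonneg fun _ _ => abs_nonneg _
  obtain ⟨z, hz, ht, -⟩ := exists_forall_mem_tight C id f (fun _ => -M) (fun U hU => by
      have h1 : |f U| ≤ M :=
        Finset.single_le_sum (f := fun U => |f U|) (fun _ _ => abs_nonneg _) hU
      have h2 : (1 : ℝ) ≤ U.card := by exact_mod_cast Finset.card_pos.2 ((memC U).1 hU).2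
      have h3 := neg_abs_le (f U)
      simp only [id, Finset.sum_const, nsmul_eq_mul]
      nlinarith) R
    (fun i hi => ⟨R, (memC R).2 ⟨subset_rfl, i, hi⟩, hi⟩)
  simp only [id] at hz ht
  refine ⟨z, fun U hU hne => hz U ((memC U).2 ⟨hU, hne⟩), ?_⟩
  -- `D` holds the tight sets, and `Q` the maximal ones among them
  set D : Finset (Finset α) := C.filter fun U => ∑ i ∈ U, z i = f U with hD
  have memD : ∀ U, U ∈ D ↔ U ∈ C ∧ ∑ i ∈ U, z i = f U := by simp [hD]
  have hunion : ∀ U ∈ D, ∀ W ∈ D, (U ∩ W).Nonempty → U ∪ W ∈ D := by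
    intro U hU W hW hne
    obtain ⟨hUC, hUt⟩ := (memD U).1 hU
    obtain ⟨hWC, hWt⟩ := (memD W).1 hW
    have hUR := ((memC U).1 hUC).1
    have hWR := ((memC W).1 hWC).1
    have h1 : U ∪ W ∈ C := (memC _).2
      ⟨Finset.union_subset hUR hWR, hne.mono fun i hi =>
        Finset.mem_union_left _ (Finset.mem_inter.1 hi).1⟩
    have h2 : U ∩ W ∈ C := (memC _).2 ⟨Finset.inter_subset_left.trans hUR, hne⟩
    have h3 := hf U hUR W hWR hne
    have h4 := hz _ h1
    have h5 := hz _ h2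
    have h6 := Finset.sum_union_inter (s₁ := U) (s₂ := W) (f := z)
    exact (memD _).2 ⟨h1, by linarith⟩
  set Q : Finset (Finset α) := D.filter fun T => ∀ W ∈ D, (T ∩ W).Nonempty → W ⊆ T with hQ
  have memQ : ∀ T, T ∈ Q ↔ T ∈ D ∧ ∀ W ∈ D, (T ∩ W).Nonempty → W ⊆ T := by simp [hQ]
  let π : Finpartition R := Finpartition.ofExistsUnique Q
    (fun T hT => ((memC T).1 ((memD T).1 ((memQ T).1 hT).1).1).1)
    (fun i hi => by
      obtain ⟨c, hc, hic, hct⟩ := ht i hi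
      obtain ⟨T, hT, hmax⟩ := Finset.exists_max_image (D.filter fun U => i ∈ U)
        (fun U => U.card) ⟨c, by simp [memD, hc, hic, hct]⟩
      rw [Finset.mem_filter] at hT
      refine ⟨T, ⟨(memQ T).2 ⟨hT.1, fun W hW hne => ?_⟩, hT.2⟩, fun T' hT' => ?_⟩
      · have hTW := hmax (T ∪ W) (by simp [hunion T hT.1 W hW hne, hT.2])
        rw [Finset.eq_of_subset_of_card_le Finset.subset_union_left hTW]
        exact Finset.subset_union_right
      · obtain ⟨hT'D, hT'max⟩ := (memQ T').1 hT'.1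
        refine Finset.Subset.antisymm ?_ (hT'max T hT.1 ⟨i, by simp [hT.2, hT'.2]⟩)
        have hTW := hmax (T ∪ T') (by
          simp [hunion T hT.1 T' hT'D ⟨i, by simp [hT.2, hT'.2]⟩, hT.2])
        rw [Finset.eq_of_subset_of_card_le Finset.subset_union_left hTW]
        exact Finset.subset_union_right)
    (fun h => by simpa using ((memC _).1 ((memD _).1 ((memQ _).1 h).1).1).2)
  refine (hm π).trans_eq ?_
  have h1 : ∑ P ∈ π.parts, f P = ∑ P ∈ π.parts, ∑ i ∈ P, z i :=
    Finset.sum_congr rfl fun P hP => (((memD P).1 ((memQ P).1 hP).1).2).symm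
  rw [h1, ← Finset.sum_congr π.biUnion_parts fun _ _ => rfl]
  exact (Finset.sum_biUnion π.disjoint).symm

/-! ### Transportation -/

/-- One step of the transportation argument: a supermodular demand `h` that is at most `c`, and
nonpositive on the sets that miss `K`, is met by distributing at most `c` over `K`. -/
theorem exists_le_sum_of_supermodular {α : Type*} [DecidableEq α] (R K : Finset α) (c : ℝ)
    (hc : 0 ≤ c) (h : Finset α → ℝ) (h_empty : h ∅ = 0)
    (hsup : ∀ U ⊆ R, ∀ W ⊆ R, h U + h W ≤ h (U ∪ W) + h (U ∩ W))
    (hle : ∀ U ⊆ R, h U ≤ if (K ∩ U).Nonempty then c else 0) :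
    ∃ p : α → ℝ, (∀ i, 0 ≤ p i) ∧ (∀ i ∉ K, p i = 0) ∧ (∀ U ⊆ R, h U ≤ ∑ i ∈ U, p i) ∧
      ∑ i ∈ R, p i ≤ c := by
  -- lowering `p` to a minimal solution is raising `-p`; nonnegativity of `p` gives the
  -- constraints of the second summand
  obtain ⟨q, hq, ht, hout⟩ := exists_forall_mem_tight (R.powerset.disjSum K)
    (Sum.elim id fun i => {i}) (Sum.elim (fun U => -h U) fun _ => 0)
    (fun i => if i ∈ K then -c else 0) (by
      rintro (U | i) hU
      · have hUR : U ⊆ R := by simpa using hU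
        simp only [Sum.elim_inl, id]
        rw [← Finset.sum_filter, Finset.sum_const, nsmul_eq_mul]
        have h1 := hle U hUR
        split_ifs at h1 with hne
        · have h2 : (1 : ℝ) ≤ (U.filter fun i => i ∈ K).card := by
            obtain ⟨j, hj⟩ := hne
            rw [Finset.mem_inter] at hj
            exact_mod_cast Finset.card_pos.2 ⟨j, by simp [hj.1, hj.2]⟩
          nlinarith
        · have h2 : (0 : ℝ) ≤ (U.filter fun i => i ∈ K).card := by positivity
          nlinarith
      · have hi : i ∈ K := by simpa using hU
        simpa [hi] using hc) K (fun i hi => ⟨Sum.inr i, by simp [hi], by simp⟩)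
  have hqU : ∀ U ⊆ R, ∑ i ∈ U, q i ≤ -h U := fun U hU => by
    simpa using hq (Sum.inl U) (by simpa using hU)
  have hq0 : ∀ i, q i ≤ 0 := fun i => by
    by_cases hi : i ∈ K
    · simpa using hq (Sum.inr i) (by simpa using hi)
    · simp [hout i hi, hi]
  -- tight sets are closed under union, so there is a largest one, and `q` vanishes outside it
  set D : Finset (Finset α) := R.powerset.filter fun U => ∑ i ∈ U, q i = -h U with hD
  have memD : ∀ U, U ∈ D ↔ U ⊆ R ∧ ∑ i ∈ U, q i = -h U := by simp [hD]
  obtain ⟨T, hT, hmax⟩ := Finset.exists_max_image D (fun U => U.card)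
    ⟨∅, (memD ∅).2 (by simp [h_empty])⟩
  have hTmax : ∀ W ∈ D, W ⊆ T := by
    intro W hW
    obtain ⟨hTR, hTt⟩ := (memD T).1 hT
    obtain ⟨hWR, hWt⟩ := (memD W).1 hW
    have h1 := hsup T hTR W hWR
    have h2 := hqU _ (Finset.union_subset hTR hWR)
    have h3 := hqU _ ((Finset.inter_subset_left (s₂ := W)).trans hTR)
    have h4 := Finset.sum_union_inter (s₁ := T) (s₂ := W) (f := q)
    have h5 := hmax (T ∪ W) ((memD _).2 ⟨Finset.union_subset hTR hWR, by linarith⟩)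
    rw [Finset.eq_of_subset_of_card_le Finset.subset_union_left h5]
    exact Finset.subset_union_right
  obtain ⟨hTR, hTt⟩ := (memD T).1 hT
  refine ⟨fun i => -q i, fun i => by linarith [hq0 i], fun i hi => by simp [hout i hi, hi],
    fun U hU => ?_, ?_⟩
  · rw [Finset.sum_neg_distrib]
    linarith [hqU U hU]
  · have h1 : ∑ i ∈ T, q i = ∑ i ∈ R, q i := Finset.sum_subset hTR fun i _ hiT => by
      by_cases hi : i ∈ K
      · obtain ⟨U | j, hU, hiU, hUt⟩ := ht i hi
        · exact absurd (hTmax U ((memD U).2 ⟨by simpa using hU, by simpa using hUt⟩)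
            (by simpa using hiU)) hiT
        · have hij : i = j := by simpa using hiU
          simpa [hij] using hUt
      · simp [hout i hi, hi]
    rw [Finset.sum_neg_distrib, ← h1, hTt, neg_neg]
    exact (hle T hTR).trans (by split_ifs <;> simp [hc])

/-- The total weight of the members of a weighted family of sets that meet `U`. -/
noncomputable def coverage {α κ : Type*} [DecidableEq α] (H : Finset κ) (S : κ → Finset α)
    (x : κ → ℝ) (U : Finset α) : ℝ :=
  ∑ k ∈ H, if (S k ∩ U).Nonempty then x k else 0

theorem coverage_union_add_inter_le {α κ : Type*} [DecidableEq α] (H : Finset κ)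
    (S : κ → Finset α) (x : κ → ℝ) (hx : ∀ k, 0 ≤ x k) (U W : Finset α) :
    coverage H S x (U ∪ W) + coverage H S x (U ∩ W) ≤ coverage H S x U + coverage H S x W := by
  unfold coverage
  rw [← Finset.sum_add_distrib, ← Finset.sum_add_distrib]
  refine Finset.sum_le_sum fun k _ => ?_
  have h1 : (S k ∩ (U ∪ W)).Nonempty ↔ (S k ∩ U).Nonempty ∨ (S k ∩ W).Nonempty := by
    rw [Finset.inter_union_distrib_left, Finset.union_nonempty]
  have h2 : (S k ∩ (U ∩ W)).Nonempty → (S k ∩ U).Nonempty ∧ (S k ∩ W).Nonempty := fun h =>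
    ⟨h.mono (by grind), h.mono (by grind)⟩
  have := hx k
  by_cases hU : (S k ∩ U).Nonempty <;> by_cases hW : (S k ∩ W).Nonempty <;>
    by_cases hUW : (S k ∩ (U ∩ W)).Nonempty <;> simp_all

theorem coverage_le_sum {α κ : Type*} [DecidableEq α] (H : Finset κ) (S : κ → Finset α)
    (x : κ → ℝ) (hx : ∀ k, 0 ≤ x k) (U : Finset α) : coverage H S x U ≤ ∑ k ∈ H, x k :=
  Finset.sum_le_sum fun k _ => by split_ifs <;> simp [hx k]

/-- A fractional form of Hall's theorem: supplies `x k`, each of which may be sent to the points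
of `S k`, can be distributed so that every point `i` receives exactly its demand `z i`, provided
that the demand of every set is at most the supply that can reach it and that the totals agree. -/
theorem exists_transport {α κ : Type*} [DecidableEq α] [DecidableEq κ] (R : Finset α)
    (S : κ → Finset α) (hS : ∀ k, S k ⊆ R) (x : κ → ℝ) (hx : ∀ k, 0 ≤ x k) (H : Finset κ) :
    ∀ z : α → ℝ, (∀ U ⊆ R, ∑ i ∈ U, z i ≤ coverage H S x U) → ∑ k ∈ H, x k ≤ ∑ i ∈ R, z i →
    ∃ y : κ → α → ℝ, (∀ k i, 0 ≤ y k i) ∧ (∀ k ∈ H, ∑ i ∈ S k, y k i = x k) ∧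
      (∀ k, ∀ i ∉ S k, y k i = 0) ∧ ∀ i ∈ R, ∑ k ∈ H, y k i = z i := by
  induction H using Finset.induction_on with
  | empty =>
    intro z hz hR
    have hz0 : ∀ i ∈ R, z i ≤ 0 := fun i hi => by
      simpa [coverage] using hz {i} (by simpa using hi)
    have h0 := (Finset.sum_eq_zero_iff_of_nonpos hz0).1
      (le_antisymm (Finset.sum_nonpos hz0) (by simpa using hR))
    exact ⟨fun _ _ => 0, by simp, by simp, by simp, fun i hi => by simp [h0 i hi]⟩
  | insert a H ha ih =>
    intro z hz hR
    have hcov : ∀ U, coverage (insert a H) S x U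
        = (if (S a ∩ U).Nonempty then x a else 0) + coverage H S x U := fun U => by
      rw [coverage, Finset.sum_insert ha]; rfl
    rw [Finset.sum_insert ha] at hR
    -- the demand that the other supplies cannot meet has to be met by `x a`
    obtain ⟨p, hp0, hpS, hpU, hpR⟩ := exists_le_sum_of_supermodular R (S a) (x a) (hx a)
      (fun U => ∑ i ∈ U, z i - coverage H S x U) (by simp [coverage])
      (fun U _ W _ => by
        have h1 := coverage_union_add_inter_le H S x hx U W
        have h2 := Finset.sum_union_inter (s₁ := U) (s₂ := W) (f := z)
        linarith)
      (fun U hU => by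
        have := hz U hU
        rw [hcov] at this
        linarith)
    obtain ⟨y, hy0, hyx, hyS, hyz⟩ := ih (fun i => z i - p i)
      (fun U hU => by
        rw [Finset.sum_sub_distrib]
        linarith [hpU U hU])
      (by rw [Finset.sum_sub_distrib]; linarith)
    have hpa : ∑ i ∈ S a, p i = x a := by
      rw [Finset.sum_subset (hS a) fun i _ hi => hpS i hi]
      have h1 := hpU R subset_rfl
      have h2 := coverage_le_sum H S x hx R
      linarith
    refine ⟨Function.update y a p, fun k i => ?_, fun k hk => ?_, fun k i hi => ?_,
      fun i hi => ?_⟩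
    · by_cases hka : k = a
      · subst hka; simpa using hp0 i
      · simpa [hka] using hy0 k i
    · rcases Finset.mem_insert.1 hk with rfl | hk
      · simpa using hpa
      · have hka : k ≠ a := fun h => ha (h ▸ hk)
        simpa [hka] using hyx k hk
    · by_cases hka : k = a
      · subst hka; simpa using hpS i hi
      · simpa [hka] using hyS k i hi
    · rw [Finset.sum_insert ha, Function.update_self]
      have h1 : ∑ k ∈ H, Function.update y a p k i = ∑ k ∈ H, y k i :=
        Finset.sum_congr rfl fun k hk => by
          have hka : k ≠ a := fun h => ha (h ▸ hk)
          rw [Function.update_of_ne hka]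
      rw [h1, hyz i hi]
      ring

/-! ### Forgetting and choosing heads -/

namespace SteinerInstance

variable {V : Type*} [DecidableEq V]

theorem Hyperedge.subset {V : Type*} {I : SteinerInstance V} (K : I.Hyperedge) :
    K.1 ⊆ I.terminals :=
  Finset.mem_powerset.1 (Finset.mem_filter.1 K.2).1

theorem Hyperedge.nonempty {V : Type*} {I : SteinerInstance V} (K : I.Hyperedge) : K.1.Nonempty :=
  (Finset.mem_filter.1 K.2).2

/-- The undirected solution in which every hyperedge has the total weight of its directions. -/
noncomputable def forgetHeads {V : Type*} (I : SteinerInstance V) (y : I.DirHyperedge → ℝ≥0) :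
    I.Hyperedge → ℝ≥0 :=
  fun K => ∑ i : {i : V // i ∈ K.1}, y ⟨K, i⟩

theorem partitionObjective_forgetHeads {V : Type*} (I : SteinerInstance V)
    (y : I.DirHyperedge → ℝ≥0) :
    I.partitionObjective (I.forgetHeads y) = I.directedObjective y := by
  simp only [partitionObjective, directedObjective, forgetHeads, Fintype.sum_sigma,
    ENNReal.ofNNReal_finsetSum, Finset.mul_sum]

theorem sum_outHyperedges (I : SteinerInstance V) (U : Finset V) (y : I.Hyperedge → V → ℝ) :
    ∑ e ∈ I.outHyperedges U, y e.1 e.2 =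
      ∑ K : I.Hyperedge, ∑ i ∈ K.1, if (U ∩ K.1).Nonempty ∧ i ∉ U then y K i else 0 := by
  rw [outHyperedges, Finset.sum_filter, Fintype.sum_sigma]
  exact Finset.sum_congr rfl fun K _ =>
    Finset.sum_coe_sort K.1 fun i => if (U ∩ K.1).Nonempty ∧ i ∉ U then y K i else 0

/-- Summing the constraints of the parts that avoid the root: `K` directed towards `i` leaves only
parts that meet `K` and do not contain `i`, and there are at most `rankContribution π K` of
these. -/
theorem DirectedFeasible.partitionFeasible_forgetHeads {I : SteinerInstance V} {r : V}
    (hr : r ∈ I.terminals) {y : I.DirHyperedge → ℝ≥0} (hy : I.DirectedFeasible r y) :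
    I.PartitionFeasible (I.forgetHeads y) := by
  intro π
  have hpart : π.part r ∈ π.parts := π.part_mem.2 hr
  have hlow : ∀ P ∈ π.parts.erase (π.part r),
      (1 : ℝ) ≤ ∑ e : I.DirHyperedge,
        if (P ∩ e.1.1).Nonempty ∧ e.2.1 ∉ P then (y e : ℝ) else 0 := by
    intro P hP
    obtain ⟨hne, hP⟩ := Finset.mem_erase.1 hP
    have h := hy P ⟨π.le hP, π.nonempty_of_mem_parts hP, fun h => hne (π.part_eq_of_mem hP h).symm⟩
    rw [outHyperedges, Finset.sum_filter] at h
    have h' := NNReal.coe_le_coe.2 h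
    rw [NNReal.coe_one, NNReal.coe_sum] at h'
    simpa only [apply_ite NNReal.toReal, NNReal.coe_zero] using h'
  have h1 : (π.parts.card : ℝ) - 1 = ∑ P ∈ π.parts.erase (π.part r), (1 : ℝ) := by
    rw [Finset.sum_const, nsmul_eq_mul, mul_one, Finset.card_erase_of_mem hpart,
      Nat.cast_pred (Finset.card_pos.2 ⟨_, hpart⟩)]
  rw [h1]
  refine (Finset.sum_le_sum hlow).trans ?_
  rw [Finset.sum_comm, Fintype.sum_sigma]
  refine Finset.sum_le_sum fun K _ => ?_
  rw [forgetHeads, NNReal.coe_sum, Finset.sum_mul]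
  refine Finset.sum_le_sum fun i _ => ?_
  rw [← Finset.sum_filter, Finset.sum_const, nsmul_eq_mul, mul_comm]
  refine mul_le_mul_of_nonneg_left ?_ (y ⟨K, i⟩).2
  have hi : i.1 ∈ I.terminals := K.subset i.2
  have hip : π.part i.1 ∈ π.parts.filter fun P => (K.1 ∩ P).Nonempty :=
    Finset.mem_filter.2 ⟨π.part_mem.2 hi, i.1, Finset.mem_inter.2 ⟨i.2, π.mem_part hi⟩⟩
  rw [rankContribution, ← Nat.cast_pred (Finset.card_pos.2 ⟨_, hip⟩),
    ← Finset.card_erase_of_mem hip]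
  refine Nat.cast_le.2 (Finset.card_le_card fun P hP => ?_)
  rw [Finset.mem_filter, Finset.mem_erase] at hP
  refine Finset.mem_erase.2 ⟨?_, Finset.mem_filter.2 ⟨hP.1.2, ?_⟩⟩
  · rintro rfl
    exact hP.2.2 (π.mem_part hi)
  · rw [Finset.inter_comm]
    exact hP.2.1

/-- Summed over the parts of `π`, the upper bounds on the weight directed towards a set exceed the
total weight of `x` by the slack of the constraint of `π` in the partition LP. -/
theorem sum_le_sum_parts {I : SteinerInstance V} {r : V} (hr : r ∈ I.terminals)
    {x : I.Hyperedge → ℝ≥0} (hx : I.PartitionFeasible x) (π : Finpartition I.terminals) :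
    ∑ K, (x K : ℝ) ≤ ∑ P ∈ π.parts, (coverage Finset.univ (fun K : I.Hyperedge => K.1)
      (fun K => (x K : ℝ)) P - if r ∈ P then 0 else 1) := by
  have hpart : π.part r ∈ π.parts := π.part_mem.2 hr
  have h1 : ∑ P ∈ π.parts, (if r ∈ P then (0 : ℝ) else 1) = π.parts.card - 1 := by
    have h : ∀ P ∈ π.parts, (if r ∈ P then (0 : ℝ) else 1) = 1 - if π.part r = P then 1 else 0 := by
      intro P hP
      by_cases hrP : r ∈ P
      · simp [hrP, π.part_eq_of_mem hP hrP]
      · have : π.part r ≠ P := fun h => hrP (h ▸ π.mem_part hr)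
        simp [hrP, this]
    rw [Finset.sum_congr rfl h, Finset.sum_sub_distrib, Finset.sum_ite_eq, if_pos hpart]
    simp
  have h2 : ∑ P ∈ π.parts, coverage Finset.univ (fun K : I.Hyperedge => K.1)
      (fun K => (x K : ℝ)) P = ∑ K : I.Hyperedge, (x K : ℝ) * rankContribution π K.1
        + ∑ K, (x K : ℝ) := by
    unfold coverage
    rw [Finset.sum_comm, ← Finset.sum_add_distrib]
    refine Finset.sum_congr rfl fun K _ => ?_
    rw [← Finset.sum_filter, Finset.sum_const, nsmul_eq_mul, rankContribution]
    ring
  rw [Finset.sum_sub_distrib, h1, h2]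
  linarith [hx π]

/-- Orientation: the weight of every hyperedge in a solution of the partition LP can be split
among its heads so as to give a solution of the directed LP. With `z i` the weight directed
towards `i`, the constraint of `U` says that `z(U)` is at most the weight that meets `U`,
minus one. -/
theorem PartitionFeasible.exists_directedFeasible {I : SteinerInstance V} {r : V}
    (hr : r ∈ I.terminals) {x : I.Hyperedge → ℝ≥0} (hx : I.PartitionFeasible x) :
    ∃ y : I.DirHyperedge → ℝ≥0, I.DirectedFeasible r y ∧ I.forgetHeads y = x := by
  set cov : Finset V → ℝ := coverage Finset.univ (fun K : I.Hyperedge => K.1)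
    (fun K => (x K : ℝ)) with hcov
  have hx0 : ∀ K, (0 : ℝ) ≤ x K := fun K => (x K).2
  obtain ⟨z, hz, hzR⟩ := exists_le_intersecting_submodular I.terminals
    (fun U => cov U - if r ∈ U then 0 else 1) (∑ K, (x K : ℝ))
    (fun U _ W _ _ => by
      have h1 : cov (U ∪ W) + cov (U ∩ W) ≤ cov U + cov W :=
        coverage_union_add_inter_le _ _ _ hx0 U W
      by_cases hU : r ∈ U <;> by_cases hW : r ∈ W <;> simp [hU, hW] <;> linarith)
    (sum_le_sum_parts hr hx)
  obtain ⟨y, hy0, hyx, hyS, hyz⟩ := exists_transport I.terminals (fun K : I.Hyperedge => K.1)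
    Hyperedge.subset (fun K => (x K : ℝ)) hx0 Finset.univ z (fun U hU => by
      rcases U.eq_empty_or_nonempty with rfl | hne
      · simp [coverage]
      · refine (hz U hU hne).trans ?_
        change cov U - _ ≤ cov U
        split_ifs <;> linarith) hzR
  refine ⟨fun e => (y e.1 e.2).toNNReal, fun U hU => ?_, ?_⟩
  · have h1 := hz U hU.1 hU.2.1
    rw [if_neg hU.2.2] at h1
    have h2 : ∑ i ∈ U, z i = ∑ K : I.Hyperedge, ∑ i ∈ U, y K i := by
      rw [Finset.sum_comm]
      exact Finset.sum_congr rfl fun i hi => (hyz i (hU.1 hi)).symm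
    have h3 : cov U - ∑ i ∈ U, z i = ∑ e ∈ I.outHyperedges U, y e.1 e.2 := by
      rw [sum_outHyperedges, h2, hcov, coverage, ← Finset.sum_sub_distrib]
      refine Finset.sum_congr rfl fun K _ => ?_
      have h4 : ∑ i ∈ U, y K i = ∑ i ∈ K.1, if i ∈ U then y K i else 0 := by
        rw [← Finset.sum_filter, Finset.filter_mem_eq_inter, Finset.inter_comm]
        exact (Finset.sum_subset Finset.inter_subset_left fun i hi hi' =>
          hyS K i fun h => hi' (Finset.mem_inter.2 ⟨hi, h⟩)).symm
      rw [h4, Finset.inter_comm K.1 U]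
      split_ifs with hne
      · rw [← hyx K (Finset.mem_univ K), ← Finset.sum_sub_distrib]
        refine Finset.sum_congr rfl fun i _ => ?_
        by_cases hi : i ∈ U <;> simp [hi, hne]
      · rw [zero_sub, ← Finset.sum_neg_distrib]
        refine Finset.sum_congr rfl fun i hi => ?_
        have : i ∉ U := fun h => hne ⟨i, Finset.mem_inter.2 ⟨h, hi⟩⟩
        simp [this, hne]
    rw [← NNReal.coe_le_coe, NNReal.coe_sum, NNReal.coe_one]
    simp only [Real.coe_toNNReal _ (hy0 _ _)]
    linarith
  · funext K
    rw [← NNReal.coe_inj, ← hyx K (Finset.mem_univ K)]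
    simp only [forgetHeads, NNReal.coe_sum, Real.coe_toNNReal _ (hy0 _ _)]
    exact Finset.sum_coe_sort K.1 (y K)

/-- The two LPs have the same objective values, not only the same optimum. -/
theorem partitionValues_eq_directedValues {I : SteinerInstance V} {r : V}
    (hr : r ∈ I.terminals) : I.partitionValues = I.directedValues r := by
  ext v
  constructor
  · rintro ⟨x, hx, rfl⟩
    obtain ⟨y, hy, rfl⟩ := PartitionFeasible.exists_directedFeasible hr hx
    exact ⟨y, hy, (I.partitionObjective_forgetHeads y).symm⟩
  · rintro ⟨y, hy, rfl⟩
    exact ⟨_, DirectedFeasible.partitionFeasible_forgetHeads hr hy,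
      I.partitionObjective_forgetHeads y⟩

/-! ### Attainment -/

/-- All weights equal to one are feasible: for valid `U`, the pair of some `u ∈ U` and the root,
directed towards the root, leaves `U`. -/
theorem directedFeasible_one {I : SteinerInstance V} {r : V} (hr : r ∈ I.terminals) :
    I.DirectedFeasible r fun _ => 1 := by
  rintro U ⟨hU, ⟨u, hu⟩, hrU⟩
  have hK : ({u, r} : Finset V) ∈ I.hyperedges := by
    simp [hyperedges, Finset.insert_subset_iff, hU hu, hr]
  rw [Finset.sum_const, nsmul_eq_mul, mul_one, Nat.one_le_cast]
  refine Finset.card_pos.2 ⟨⟨⟨{u, r}, hK⟩, ⟨r, by simp⟩⟩, ?_⟩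
  simp only [outHyperedges, Finset.mem_filter, Finset.mem_univ, true_and]
  exact ⟨⟨u, by simp [hu]⟩, hrU⟩

/-- The constraints of the directed LP have coefficients `0` and `1` and right-hand side `1`, so
no weight needs to exceed one. -/
theorem DirectedFeasible.min_one {I : SteinerInstance V} {r : V} {y : I.DirHyperedge → ℝ≥0}
    (hy : I.DirectedFeasible r y) : I.DirectedFeasible r fun e => min (y e) 1 := by
  intro U hU
  by_cases h : ∃ e ∈ I.outHyperedges U, 1 ≤ y e
  · obtain ⟨e, he, h1⟩ := h
    calc (1 : ℝ≥0) = min (y e) 1 := (min_eq_right h1).symm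
      _ ≤ _ := Finset.single_le_sum (f := fun e => min (y e) 1) (fun _ _ => zero_le) he
  · push Not at h
    refine (hy U hU).trans_eq (Finset.sum_congr rfl fun e he => (min_eq_left (h e he).le).symm)

/-- Only lower semicontinuity is available, because `∞ * x` jumps at `x = 0`. -/
theorem lowerSemicontinuous_directedObjective {V : Type*} (I : SteinerInstance V) :
    LowerSemicontinuous I.directedObjective := by
  refine lowerSemicontinuous_sum fun e _ => ?_
  by_cases hc : I.hyperedgeCost e.1.1 = ∞
  · intro y a ha
    simp only [hc] at ha ⊢
    have hy : 0 < y e := by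
      rw [pos_iff_ne_zero]
      intro h0
      simp [h0] at ha
    filter_upwards [(continuous_apply e).continuousAt.eventually (lt_mem_nhds hy)] with y' hy'
    rw [ENNReal.top_mul (by simpa using hy.ne')] at ha
    rwa [ENNReal.top_mul (by simpa using hy'.ne')]
  · exact ((ENNReal.continuous_const_mul hc).comp
      (ENNReal.continuous_coe.comp (continuous_apply e))).lowerSemicontinuous

theorem isClosed_directedFeasible (I : SteinerInstance V) (r : V) :
    IsClosed {y | I.DirectedFeasible r y} := by
  simp only [DirectedFeasible, Set.ofPred_forall]
  exact isClosed_iInter fun U => isClosed_iInter fun _ =>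
    isClosed_le continuous_const (continuous_finsetSum _ fun e _ => continuous_apply e)

theorem isLeast_directedValues {I : SteinerInstance V} {r : V} (hr : r ∈ I.terminals) :
    IsLeast (I.directedValues r) (I.optDirected r) := by
  have hcpt : IsCompact ({y | I.DirectedFeasible r y} ∩ Set.Icc 0 1) :=
    isCompact_Icc.inter_left (I.isClosed_directedFeasible r)
  have hne : ({y | I.DirectedFeasible r y} ∩ Set.Icc 0 1).Nonempty :=
    ⟨fun _ => 1, directedFeasible_one hr, fun _ => zero_le, fun _ => le_rfl⟩
  obtain ⟨y, ⟨hy, -⟩, hmin⟩ :=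
    (I.lowerSemicontinuous_directedObjective.lowerSemicontinuousOn _).exists_isMinOn hne hcpt
  have hleast : IsLeast (I.directedValues r) (I.directedObjective y) := by
    refine ⟨⟨y, hy, rfl⟩, ?_⟩
    rintro _ ⟨w, hw, rfl⟩
    refine (hmin ⟨hw.min_one, fun _ => zero_le, fun _ => min_le_right _ _⟩).trans ?_
    exact Finset.sum_le_sum fun e _ =>
      mul_le_mul_right (ENNReal.coe_le_coe.2 (min_le_left _ _)) _
  rwa [optDirected, hleast.csInf_eq]

end SteinerInstance

theorem mainTheorem5 {V : Type*} [Finite V] [DecidableEq V] (I : SteinerInstance V)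
    (r : V) (hr : r ∈ I.terminals) :
    IsLeast I.partitionValues I.optPartition ∧
    IsLeast (I.directedValues r) (I.optDirected r) ∧
    I.optPartition = I.optDirected r := by
  have hopt : I.optPartition = I.optDirected r := by
    rw [SteinerInstance.optPartition, SteinerInstance.partitionValues_eq_directedValues hr,
      SteinerInstance.optDirected]
  have hleast := SteinerInstance.isLeast_directedValues hr
  refine ⟨?_, hleast, hopt⟩
  rwa [hopt, SteinerInstance.partitionValues_eq_directedValues hr]
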